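/- Let $\mathbb Z_3=\{0,1,2\}$. For a sequence $u\in\mathbb Z_3^m$ and an integer $s\ge 0$ let $D_s(u)$ be the set of all sequences of length $m-s$ obtained from $u$ by deleting exactly $s$ symbols (empty if $s>m$). For $u,v\in\mathbb Z_3^m$ the Levenshtein distance is $d_L(u,v)=\min\{s\ge0 : D_s(u)\cap D_s(v)\ne\emptyset\}$. Put $$N_3(n,2,t)=\max\{|D_t(u)\cap D_t(v)| : u,v\in\mathbb Z_3^n,\ d_L(u,v)\ge2\},$$ and, for integers $m,s$, let $D_3(m,s)=\max\{|D_s(u)| : u\in\mathbb Z_3^m\}$ if $m,s\ge 0$ (so $D_3(m,s)=0$ if $s>m$, and $D_3(m,m)=1$), and $D_3(m,s)=0$ if $m<0$ or $s<0$. Define $$\begin{aligned}M_0(n,t)={}&D_3(n-4,t-2)+3D_3(n-5,t-2)+4D_3(n-5,t-3)+3D_3(n-6,t-3)+D_3(n-6,t-4)\\&+2D_3(n-7,t-3)+2D_3(n-7,t-4)+D_3(n-8,t-4)+D_3(n-12,t-7)-D_3(n-10,t-5),\end{aligned}$$ $$M_1(n,t)=D_3(n-4,t-2)+5D_3(n-5,t-2)+4D_3(n-5,t-3)+3D_3(n-6,t-3)+D_3(n-6,t-4)+D_3(n-8,t-5).$$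 Let $\mathbf a_k=(0,1,2,0,1,2,\dots)$ be the periodic sequence of length $k$. Theorem. Let $t\ge2$ and $n\ge\max\{6,\lfloor3t/2\rfloor+1\}$ be integers. Then $$N_3(n,2,t)\ge\max\{M_0(n,t),M_1(n,t)\}.$$ Moreover, the sequences $x=(0,1,2,0,1,2,\mathbf a_{n-6})$ and $y=(1,0,2,1,0,2,\mathbf a_{n-6})$ of length $n$ satisfy $d_L(x,y)=2$ and $|D_t(x)\cap D_t(y)|=M_1(n,t)$. The sequences $x_0=(0,1,2,\mathbf a_{n-5},c,b)$ and $y_0=(1,0,2,\mathbf a_{n-3})$ of length $n$, where $b,c$ are the last two symbols of $\mathbf a_{n-3}=(\mathbf a_{n-5},b,c)$, satisfy $d_L(x_0,y_0)=2$, and if $n\ge9$, then $|D_t(x_0)\cap D_t(y_0)|=M_0(n,t)$. -/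

import Mathlib

namespace DeletionChannel

/-- The deletion ball `D_t(x)`: all sequences obtained from `x` by deleting exactly `t` symbols,
that is, the subsequences of `x` of length `|x| - t`. It is empty when `t > |x|`. -/
def deletionBall {α : Type*} [DecidableEq α] (t : ℕ) (x : List α) : Finset (List α) :=
  x.sublists.toFinset.filter fun z => z.length + t = x.length

theorem mem_deletionBall {α : Type*} [DecidableEq α] {t : ℕ} {x z : List α} :
    z ∈ deletionBall t x ↔ z.Sublist x ∧ z.length + t = x.length := by
  simp [deletionBall]

/-- The Levenshtein distance: the least `s` such that deleting `s` symbols from the shorter and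
`s + k` symbols from the longer sequence can give the same result, where `k` is the difference of
the lengths. One of the two truncated differences is always `0`; both are if the lengths agree. -/
noncomputable def levenshteinDist {α : Type*} [DecidableEq α] (x y : List α) : ℕ :=
  sInf {s : ℕ | (deletionBall (s + (x.length - y.length)) x ∩
    deletionBall (s + (y.length - x.length)) y).Nonempty}

/-- The largest size `D_q(m, s)` of a deletion ball of radius `s` around a sequence in `ℤ_q^m`,
for integers `m` and `s`; it is `0` if `m < 0`, `s < 0` or `s > m`. -/
def maxBall (q : ℕ) (m s : ℤ) : ℕ :=
  if 0 ≤ m ∧ 0 ≤ s then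
    (Finset.univ : Finset (List.Vector (Fin q) m.toNat)).sup
      fun x => (deletionBall s.toNat x.toList).card
  else 0

/-- `N_q(n, d, t)`: the largest size of `D_t(x) ∩ D_t(y)` over all `x, y ∈ ℤ_q^n` with
Levenshtein distance at least `d`. -/
noncomputable def maxIntersection (q n d t : ℕ) : ℕ :=
  ((Finset.univ : Finset (List.Vector (Fin q) n × List.Vector (Fin q) n)).filter
    fun p => d ≤ levenshteinDist p.1.toList p.2.toList).sup
      fun p => (deletionBall t p.1.toList ∩ deletionBall t p.2.toList).card

/-- The quantity `M₀(n, t)`. -/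
def M₀ (n t : ℤ) : ℤ :=
  (maxBall 3 (n - 4) (t - 2) : ℤ) + 3 * maxBall 3 (n - 5) (t - 2) + 4 * maxBall 3 (n - 5) (t - 3)
    + 3 * maxBall 3 (n - 6) (t - 3) + maxBall 3 (n - 6) (t - 4) + 2 * maxBall 3 (n - 7) (t - 3)
    + 2 * maxBall 3 (n - 7) (t - 4) + maxBall 3 (n - 8) (t - 4) + maxBall 3 (n - 12) (t - 7)
    - maxBall 3 (n - 10) (t - 5)

/-- The quantity `M₁(n, t)`. -/
def M₁ (n t : ℤ) : ℤ :=
  (maxBall 3 (n - 4) (t - 2) : ℤ) + 5 * maxBall 3 (n - 5) (t - 2) + 4 * maxBall 3 (n - 5) (t - 3)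
    + 3 * maxBall 3 (n - 6) (t - 3) + maxBall 3 (n - 6) (t - 4) + maxBall 3 (n - 8) (t - 5)

/-- The periodic ternary sequence `a_n = (0, 1, 2, 0, 1, 2, …)` of length `n`. -/
def periodicSeq (n : ℕ) : List (Fin 3) :=
  (List.range n).map fun i => Fin.ofNat 3 i

/-- `x = (0, 1, 2, 0, 1, 2, a_{n-6})`, used for `n ≥ 6`. -/
def seqX (n : ℕ) : List (Fin 3) := [0, 1, 2, 0, 1, 2] ++ periodicSeq (n - 6)

/-- `y = (1, 0, 2, 1, 0, 2, a_{n-6})`, used for `n ≥ 6`. -/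
def seqY (n : ℕ) : List (Fin 3) := [1, 0, 2, 1, 0, 2] ++ periodicSeq (n - 6)

/-- `x₀ = (0, 1, 2, a_{n-5}, c, b)`, where `a_{n-3} = (a_{n-5}, b, c)`; used for `n ≥ 6`. -/
def seqX₀ (n : ℕ) : List (Fin 3) :=
  [0, 1, 2] ++ periodicSeq (n - 5) ++ [Fin.ofNat 3 (n - 4), Fin.ofNat 3 (n - 5)]

/-- `y₀ = (1, 0, 2, a_{n-3})`, used for `n ≥ 6`. -/
def seqY₀ (n : ℕ) : List (Fin 3) := [1, 0, 2] ++ periodicSeq (n - 3)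

/-- The last two symbols `b, c` of `a_{n-3} = (a_{n-5}, b, c)`. -/
theorem periodicSeq_last_two {n : ℕ} (hn : 5 ≤ n) :
    periodicSeq (n - 3) = periodicSeq (n - 5) ++ [Fin.ofNat 3 (n - 5), Fin.ofNat 3 (n - 4)] := by
  obtain ⟨k, rfl⟩ := Nat.exists_eq_add_of_le' hn
  simp [periodicSeq, List.range_succ, show k + 5 - 3 = k + 1 + 1 by omega,
    show k + 5 - 4 = k + 1 by omega]

end DeletionChannel

/-! Deleting `t` symbols from two sequences of length `n` with the same result means choosing a
common subsequence of length `L = n - t`, so everything is a count of common subsequences indexed by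
`L`. Such a subsequence can be embedded greedily: one starting with `a` is `a` followed by a common
subsequence of the suffixes after the first `a`. This gives a recursion on `L` (`card_common_succ`),
and by reversal one from the right (`card_common_succ'`). For a single ternary sequence of length
`m` the suffixes are at most `m-1`, `m-2`, `m-3` long, with equality for the periodic sequence.
Hence the maximal ball size is `cyclicCount`, given by a three-term recurrence
(`maxBall_eq_cyclicCount`). For both explicit pairs a few symbols are peeled off until one remainder
is a cyclic subsequence of the other, which contributes one `cyclicCount`; the only other kind of
remainder is two cyclic sequences out of phase. The resulting formulas (`card_common_seqXY`,
`card_common_seqXY₀`) give the intersection sizes, and also the distances when read at lengths `n`,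
`n-1`, `n-2`. The lower bound follows from the pairs themselves, except that `M₀` for `n ≤ 8` is
compared with `M₁` numerically. -/

namespace DeletionChannel

/-! ### Common subsequences and their recursion by first or last symbol -/

section Common

variable {α : Type*} [DecidableEq α]

/-- The common subsequences of `u` and `v` of length `L`. -/
def common (L : ℕ) (u v : List α) : Finset (List α) :=
  (u.sublists.toFinset ∩ v.sublists.toFinset).filter fun z => z.length = L

theorem mem_common {L : ℕ} {u v z : List α} :
    z ∈ common L u v ↔ z.Sublist u ∧ z.Sublist v ∧ z.length = L := by
  simp [common, and_assoc]

theorem common_comm (L : ℕ) (u v : List α) : common L u v = common L v u := by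
  ext z
  simp only [mem_common]
  tauto

/-- This is where the recursion on pairs stops: the count reduces to a deletion ball of one
sequence. -/
theorem common_of_sublist {u v : List α} (h : u.Sublist v) (L : ℕ) :
    common L u v = common L u u := by
  ext z
  simp only [mem_common]
  exact ⟨fun hz => ⟨hz.1, hz.1, hz.2.2⟩, fun hz => ⟨hz.1, hz.1.trans h, hz.2.2⟩⟩

theorem deletionBall_inter {n t : ℕ} {u v : List α} (hu : u.length = n) (hv : v.length = n)
    (ht : t ≤ n) : deletionBall t u ∩ deletionBall t v = common (n - t) u v := by
  ext z
  simp only [Finset.mem_inter, mem_deletionBall, mem_common]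
  constructor
  · rintro ⟨⟨h1, h2⟩, h3, _⟩
    exact ⟨h1, h3, by omega⟩
  · rintro ⟨h1, h2, h3⟩
    exact ⟨⟨h1, by omega⟩, h2, by omega⟩

theorem common_eq_empty {L : ℕ} {u v : List α} (h : u.length < L) : common L u v = ∅ := by
  refine Finset.eq_empty_of_forall_notMem fun z hz => ?_
  have := mem_common.1 hz
  have := this.1.length_le
  omega

@[simp] theorem common_zero (u v : List α) : common 0 u v = {[]} := by
  ext z
  simp only [mem_common, List.length_eq_zero_iff, Finset.mem_singleton]
  exact ⟨fun h => h.2.2, fun h => by simp [h]⟩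

theorem card_common_reverse (L : ℕ) (u v : List α) :
    (common L u.reverse v.reverse).card = (common L u v).card := by
  refine Finset.card_bij (fun z _ => z.reverse) ?_ ?_ ?_
  · intro z hz
    obtain ⟨h1, h2, h3⟩ := mem_common.1 hz
    exact mem_common.2 ⟨by simpa using h1.reverse, by simpa using h2.reverse, by simpa using h3⟩
  · intro a _ b _ h
    exact List.reverse_injective h
  · intro z hz
    refine ⟨z.reverse, ?_, List.reverse_reverse z⟩
    rw [mem_common] at hz ⊢
    rw [List.length_reverse, List.reverse_sublist, List.reverse_sublist]
    exact hz

/-- The part of a sequence after the first occurrence of `a`, if there is one. -/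
def after (a : α) : List α → Option (List α)
  | [] => none
  | b :: l => if b = a then some l else after a l

@[simp] theorem after_nil (a : α) : after a [] = none := rfl

@[simp] theorem after_cons (a b : α) (l : List α) :
    after a (b :: l) = if b = a then some l else after a l := rfl

/-- Greedy matching loses nothing: using the first `a` leaves the longest suffix for the rest. -/
theorem cons_sublist_iff_after {a : α} {z u : List α} :
    (a :: z).Sublist u ↔ ∃ w, after a u = some w ∧ z.Sublist w := by
  induction u with
  | nil => simp
  | cons b l ih =>
    by_cases hb : b = a
    · subst hb
      simp [List.cons_sublist_cons]
    · rw [after_cons, if_neg hb, ← ih]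
      constructor
      · intro h
        cases h with
        | cons _ h => exact h
        | cons_cons _ h => exact absurd rfl hb
      · exact fun h => h.cons b

/-- The number of common subsequences of length `L` of two sequences that may be absent. -/
def countOpt (L : ℕ) : Option (List α) → Option (List α) → ℕ
  | some u, some v => (common L u v).card
  | _, _ => 0

@[simp] theorem countOpt_some (L : ℕ) (u v : List α) :
    countOpt L (some u) (some v) = (common L u v).card := rfl

@[simp] theorem countOpt_none_left (L : ℕ) (v : Option (List α)) : countOpt L none v = 0 := rfl

@[simp] theorem countOpt_none_right (L : ℕ) (u : Option (List α)) : countOpt L u none = 0 := by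
  cases u <;> rfl

theorem card_filter_head (a : α) (L : ℕ) (u v : List α) :
    ((common (L + 1) u v).filter fun z => z.head? = some a).card
      = countOpt L (after a u) (after a v) := by
  have key : ∀ z, a :: z ∈ common (L + 1) u v ↔
      ∃ u' v', after a u = some u' ∧ after a v = some v' ∧ z ∈ common L u' v' := by
    intro z
    simp only [mem_common, cons_sublist_iff_after, List.length_cons, Nat.add_right_cancel_iff]
    constructor
    · rintro ⟨⟨u', hu, h1⟩, ⟨v', hv, h2⟩, h3⟩
      exact ⟨u', v', hu, hv, h1, h2, h3⟩
    · rintro ⟨u', v', hu, hv, h1, h2, h3⟩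
      exact ⟨⟨u', hu, h1⟩, ⟨v', hv, h2⟩, h3⟩
  have hne : ∀ z, z ∈ (common (L + 1) u v).filter (fun z => z.head? = some a) →
      ∃ w, z = a :: w ∧ a :: w ∈ common (L + 1) u v := by
    intro z hz
    rw [Finset.mem_filter] at hz
    obtain ⟨w, rfl⟩ := List.head?_eq_some_iff.1 hz.2
    exact ⟨w, rfl, hz.1⟩
  rcases hu : after a u with _ | u'
  · rw [countOpt_none_left, Finset.card_eq_zero]
    refine Finset.eq_empty_of_forall_notMem fun z hz => ?_
    obtain ⟨w, -, hw⟩ := hne z hz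
    obtain ⟨u', v', h, -⟩ := (key w).1 hw
    simp [hu] at h
  rcases hv : after a v with _ | v'
  · rw [countOpt_none_right, Finset.card_eq_zero]
    refine Finset.eq_empty_of_forall_notMem fun z hz => ?_
    obtain ⟨w, -, hw⟩ := hne z hz
    obtain ⟨u', v', -, h, -⟩ := (key w).1 hw
    simp [hv] at h
  rw [countOpt_some]
  symm
  refine Finset.card_bij (fun z _ => a :: z) ?_ ?_ ?_
  · intro z hz
    rw [Finset.mem_filter]
    exact ⟨(key z).2 ⟨u', v', hu, hv, hz⟩, rfl⟩
  · intro z _ w _ h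
    exact List.tail_eq_of_cons_eq h
  · intro z hz
    obtain ⟨w, rfl, hw⟩ := hne z hz
    obtain ⟨u₁, v₁, h1, h2, h3⟩ := (key w).1 hw
    rw [hu, Option.some.injEq] at h1
    rw [hv, Option.some.injEq] at h2
    subst h1 h2
    exact ⟨w, h3, rfl⟩

/-- Counting common subsequences by their first symbol. -/
theorem card_common_succ [Fintype α] (L : ℕ) (u v : List α) :
    (common (L + 1) u v).card = ∑ a : α, countOpt L (after a u) (after a v) := by
  simp only [← card_filter_head]
  rw [← Finset.card_biUnion]
  · congr 1
    ext z
    simp only [Finset.mem_biUnion, Finset.mem_univ, true_and, Finset.mem_filter]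
    constructor
    · intro hz
      cases z with
      | nil => simp [mem_common] at hz
      | cons a w => exact ⟨a, hz, rfl⟩
    · rintro ⟨_, h, _⟩
      exact h
  · intro a _ b _ hab
    rw [Function.onFun, Finset.disjoint_left]
    intro z h1 h2
    rw [Finset.mem_filter] at h1 h2
    exact hab (Option.some.inj (h1.2.symm.trans h2.2))

/-- The part of a sequence before the last occurrence of `a`, if there is one. -/
def before (a : α) (u : List α) : Option (List α) := (after a u.reverse).map List.reverse

@[simp] theorem before_nil (a : α) : before a [] = none := rfl

@[simp] theorem before_concat (a b : α) (l : List α) :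
    before a (l ++ [b]) = if b = a then some l else before a l := by
  unfold before
  rw [List.reverse_concat, after_cons]
  split_ifs <;> simp

theorem countOpt_before (a : α) (L : ℕ) (u v : List α) :
    countOpt L (before a u) (before a v) = countOpt L (after a u.reverse) (after a v.reverse) := by
  unfold before
  rcases after a u.reverse with _ | u'
  · simp
  rcases after a v.reverse with _ | v'
  · simp
  simp [card_common_reverse]

/-- Counting common subsequences by their last symbol. -/
theorem card_common_succ' [Fintype α] (L : ℕ) (u v : List α) :
    (common (L + 1) u v).card = ∑ a : α, countOpt L (before a u) (before a v) := by
  simp only [countOpt_before]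
  rw [← card_common_reverse, card_common_succ]

theorem levenshteinDist_eq_two {n : ℕ} {u v : List α} (hn : 2 ≤ n) (hu : u.length = n)
    (hv : v.length = n) (h0 : (common n u v).card = 0) (h1 : (common (n - 1) u v).card = 0)
    (h2 : 0 < (common (n - 2) u v).card) : levenshteinDist u v = 2 := by
  unfold levenshteinDist
  simp only [hu, hv, Nat.sub_self, Nat.add_zero]
  have mem : ∀ s ≤ n, (s ∈ {s : ℕ | (deletionBall s u ∩ deletionBall s v).Nonempty} ↔
      0 < (common (n - s) u v).card) := by
    intro s hs
    rw [Set.mem_ofPred_eq, deletionBall_inter hu hv hs, Finset.card_pos]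
  refine le_antisymm (Nat.sInf_le ((mem 2 hn).2 h2)) ?_
  refine le_csInf ⟨2, (mem 2 hn).2 h2⟩ fun s hs => ?_
  by_contra hlt
  have hs' := (mem s (by omega)).1 hs
  have : s = 0 ∨ s = 1 := by omega
  rcases this with rfl | rfl
  · rw [Nat.sub_zero] at hs'
    omega
  · omega

end Common

/-! ### The three-term recurrence and the upper bound for deletion balls -/

/-- The number of subsequences of length `L` of a cyclic ternary sequence of length `m`. -/
def cyclicCount : ℕ → ℤ → ℤ
  | 0, m => if 0 ≤ m then 1 else 0
  | L + 1, m => cyclicCount L (m - 1) + cyclicCount L (m - 2) + cyclicCount L (m - 3)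

theorem cyclicCount_succ (L : ℕ) (m : ℤ) : cyclicCount (L + 1) m
    = cyclicCount L (m - 1) + cyclicCount L (m - 2) + cyclicCount L (m - 3) := rfl

theorem cyclicCount_eq_zero {L : ℕ} {m : ℤ} (h : m < L) : cyclicCount L m = 0 := by
  induction L generalizing m with
  | zero => simpa [cyclicCount] using h
  | succ L ih =>
    push_cast at h
    rw [cyclicCount_succ, ih (by omega), ih (by omega), ih (by omega)]
    rfl

theorem cyclicCount_neg {L : ℕ} {m : ℤ} (h : m < 0) : cyclicCount L m = 0 :=
  cyclicCount_eq_zero (by omega)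

theorem cyclicCount_self (L : ℕ) : cyclicCount L L = 1 := by
  induction L with
  | zero => rfl
  | succ L ih =>
    rw [cyclicCount_succ]
    push_cast
    rw [add_sub_cancel_right, ih, cyclicCount_eq_zero (by omega), cyclicCount_eq_zero (by omega)]
    rfl

theorem cyclicCount_nonneg (L : ℕ) (m : ℤ) : 0 ≤ cyclicCount L m := by
  induction L generalizing m with
  | zero => rw [cyclicCount]; split_ifs <;> norm_num
  | succ L ih =>
    rw [cyclicCount_succ]
    have := ih (m - 1)
    have := ih (m - 2)
    have := ih (m - 3)
    omega

theorem cyclicCount_mono (L : ℕ) : Monotone (cyclicCount L) := by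
  induction L with
  | zero =>
    intro a b hab
    simp only [cyclicCount]
    split_ifs <;> omega
  | succ L ih =>
    intro a b hab
    simp only [cyclicCount_succ]
    have := @ih (a - 1) (b - 1) (by omega)
    have := @ih (a - 2) (b - 2) (by omega)
    have := @ih (a - 3) (b - 3) (by omega)
    omega

/-- Extension of a function on lengths by `0` to absent sequences. -/
def optLength {α : Type*} (g : ℤ → ℤ) : Option (List α) → ℤ
  | some u => g u.length
  | none => 0

/-- The suffixes after the first occurrences of different symbols have different lengths. -/
theorem sum_after_le {α : Type*} [DecidableEq α] {g : ℤ → ℤ} (hg : Monotone g) (h0 : ∀ m, 0 ≤ g m)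
    (u : List α) (S : Finset α) :
    ∑ a ∈ S, optLength g (after a u) ≤ ∑ i ∈ Finset.range S.card, g (u.length - 1 - i) := by
  induction u generalizing S with
  | nil =>
    simp only [after_nil, optLength, Finset.sum_const_zero]
    exact Finset.sum_nonneg fun _ _ => h0 _
  | cons b l ih =>
    -- If `b ∈ S`, it accounts for the largest term and the tail bounds the others; if not, the tail
    -- bound has every argument smaller by one, and monotonicity suffices.
    by_cases hb : b ∈ S
    · rw [← Finset.add_sum_erase S _ hb, ← Finset.card_erase_add_one hb, Finset.sum_range_succ']
      have h1 : ∑ a ∈ S.erase b, optLength g (after a (b :: l))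
          = ∑ a ∈ S.erase b, optLength g (after a l) := by
        refine Finset.sum_congr rfl fun a ha => ?_
        rw [after_cons, if_neg (Finset.ne_of_mem_erase ha).symm]
      have h2 : optLength g (after b (b :: l)) = g (((b :: l).length : ℤ) - 1 - (0 : ℕ)) := by
        simp [optLength]
      rw [h1, h2, add_comm]
      refine add_le_add_left ((ih _).trans (le_of_eq ?_)) _
      refine Finset.sum_congr rfl fun i _ => ?_
      congr 1
      push_cast [List.length_cons]
      ring
    · have h1 : ∑ a ∈ S, optLength g (after a (b :: l)) = ∑ a ∈ S, optLength g (after a l) := by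
        refine Finset.sum_congr rfl fun a ha => ?_
        rw [after_cons, if_neg]
        rintro rfl
        exact hb ha
      rw [h1]
      refine (ih S).trans (Finset.sum_le_sum fun i _ => hg ?_)
      push_cast [List.length_cons]
      omega

/-- By induction each first symbol contributes at most `cyclicCount L` of its suffix length; these
lengths are distinct, so `sum_after_le` bounds the sum by the recurrence. -/
theorem card_common_self_le (L : ℕ) (u : List (Fin 3)) :
    ((common L u u).card : ℤ) ≤ cyclicCount L u.length := by
  induction L generalizing u with
  | zero => simp [cyclicCount]
  | succ L ih =>
    rw [card_common_succ, cyclicCount_succ]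
    push_cast
    have h := sum_after_le (cyclicCount_mono L) (cyclicCount_nonneg L) u Finset.univ
    have h1 : ∀ a : Fin 3, ((countOpt L (after a u) (after a u) : ℕ) : ℤ)
        ≤ optLength (cyclicCount L) (after a u) := by
      intro a
      rcases after a u with _ | w
      · simp [optLength]
      · exact ih w
    refine (Finset.sum_le_sum fun a _ => h1 a).trans (h.trans (le_of_eq ?_))
    simp only [Finset.card_univ, Fintype.card_fin, Finset.sum_range_succ, Finset.sum_range_zero]
    push_cast
    simp only [sub_sub]
    norm_num

/-! ### Cyclic sequences attain the maximum -/

/-- The cyclic ternary sequence of length `k` that starts with `p`. -/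
def cyclic : Fin 3 → ℕ → List (Fin 3)
  | _, 0 => []
  | p, k + 1 => p :: cyclic (p + 1) k

@[simp] theorem cyclic_zero (p : Fin 3) : cyclic p 0 = [] := rfl

theorem cyclic_succ (p : Fin 3) (k : ℕ) : cyclic p (k + 1) = p :: cyclic (p + 1) k := rfl

@[simp] theorem length_cyclic (p : Fin 3) (k : ℕ) : (cyclic p k).length = k := by
  induction k generalizing p with
  | zero => rfl
  | succ k ih => rw [cyclic_succ, List.length_cons, ih]

theorem ofNat_succ (k : ℕ) : Fin.ofNat 3 (k + 1) = Fin.ofNat 3 k + 1 := by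
  ext
  simp [Fin.ofNat, Fin.val_add]

theorem cyclic_succ' (p : Fin 3) (k : ℕ) :
    cyclic p (k + 1) = cyclic p k ++ [p + Fin.ofNat 3 k] := by
  induction k generalizing p with
  | zero => simp [cyclic_succ]
  | succ k ih =>
    rw [cyclic_succ, ih, cyclic_succ p k, ofNat_succ, List.cons_append,
      show p + (Fin.ofNat 3 k + 1) = p + 1 + Fin.ofNat 3 k by
        generalize Fin.ofNat 3 k = q
        decide +revert]

theorem periodicSeq_eq_cyclic (k : ℕ) : periodicSeq k = cyclic 0 k := by
  induction k with
  | zero => rfl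
  | succ k ih => rw [cyclic_succ', ← ih, zero_add]; simp [periodicSeq, List.range_succ]

theorem cyclic_sublist_cyclic (p : Fin 3) {j k : ℕ} (h : j ≤ k) :
    (cyclic p j).Sublist (cyclic p k) := by
  induction k, h using Nat.le_induction with
  | base => exact List.Sublist.refl _
  | succ k _ ih =>
    rw [cyclic_succ']
    exact ih.trans (List.sublist_append_left _ _)

theorem sum_fin_three (f : Fin 3 → ℕ) (p : Fin 3) :
    ∑ a, f a = f p + f (p + 1) + f (p + 2) := by
  rw [Fin.sum_univ_three]
  fin_cases p <;> simp [show (2 : Fin 3) + 1 = 0 from rfl, show (2 : Fin 3) + 2 = 1 from rfl,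
    show (1 : Fin 3) + 1 = 2 from rfl, show (1 : Fin 3) + 2 = 0 from rfl] <;> omega

/-- The three symbols first occur at the first three positions, and each remaining suffix is again
cyclic, so the recurrence holds exactly. -/
theorem card_common_cyclic (L : ℕ) (p : Fin 3) (k : ℕ) :
    ((common L (cyclic p k) (cyclic p k)).card : ℤ) = cyclicCount L k := by
  induction L generalizing p k with
  | zero => simp [cyclicCount]
  | succ L ih =>
    have h1 : p ≠ p + 1 := by decide +revert
    have h2 : p ≠ p + 2 := by decide +revert
    have h3 : p + 1 ≠ p + 2 := by decide +revert
    have h4 : p + 1 + 1 = p + 2 := by decide +revert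
    rw [card_common_succ, sum_fin_three _ p, cyclicCount_succ]
    have e0 := ih p 0
    have e1 := ih (p + 1) 1
    -- For `k < 3` some symbols do not occur; the matching terms have negative length and vanish.
    rcases k with _ | _ | _ | k
    · simp [cyclicCount_neg]
    · simp only [cyclic_zero, Nat.cast_zero] at e0
      simp [cyclic_succ, h1, h2, cyclicCount_neg, e0]
    · simp only [cyclic_succ, cyclic_zero, Nat.cast_zero, Nat.cast_one] at e0 e1
      simp [cyclic_succ, h1, h2, h3, cyclicCount_neg, e0, e1]
    · have e2 := ih (p + 1) (k + 2)
      have e3 := ih (p + 2) (k + 1)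
      rw [cyclic_succ, h4] at e2
      simp only [cyclic_succ p, cyclic_succ (p + 1), h4, cyclic_succ (p + 2), after_cons, h1, h2, h3,
        if_true, if_false, countOpt_some]
      simp only [cyclic_succ (p + 2)] at e2 e3
      push_cast [e2, e3, ih]
      congr 2 <;> congr 1 <;> ring


theorem maxBall_eq_cyclicCount {m s : ℤ} {L : ℕ} (h : m - s = L) :
    (maxBall 3 m s : ℤ) = cyclicCount L m := by
  unfold maxBall
  split_ifs with hms
  · obtain ⟨hm, hs⟩ := hms
    lift m to ℕ using hm
    lift s to ℕ using hs
    have hball : ∀ u : List (Fin 3), u.length = m →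
        (deletionBall s u).card = (common L u u).card := by
      intro u hu
      rw [show L = m - s by omega, ← deletionBall_inter hu hu (by omega), Finset.inter_self]
    rw [Int.toNat_natCast, Int.toNat_natCast]
    refine le_antisymm ?_ ?_
    · rw [← Int.toNat_of_nonneg (cyclicCount_nonneg L m), Nat.cast_le]
      refine Finset.sup_le fun x _ => ?_
      rw [hball _ x.toList_length]
      have := card_common_self_le L x.toList
      rw [x.toList_length] at this
      omega
    · rw [← card_common_cyclic L 0 m, ← hball _ (length_cyclic 0 m), Nat.cast_le]
      exact Finset.le_sup (f := fun x : List.Vector (Fin 3) m => (deletionBall s x.toList).card)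
        (Finset.mem_univ (show List.Vector (Fin 3) m from ⟨cyclic 0 m, length_cyclic 0 m⟩))
  -- Here `m < 0` or `s < 0`; either way `m < L`, so both sides are zero.
  · rw [cyclicCount_eq_zero (by omega), Nat.cast_zero]

theorem maxBall_eq_zero {q : ℕ} {m s : ℤ} (h : m < s) : maxBall q m s = 0 := by
  unfold maxBall
  split_ifs with hms
  · rw [← Nat.le_zero]
    refine Finset.sup_le fun x _ => ?_
    rw [Nat.le_zero, Finset.card_eq_zero]
    refine Finset.eq_empty_of_forall_notMem fun z hz => ?_
    have := (mem_deletionBall.1 hz).2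
    rw [x.toList_length] at this
    omega
  · rfl

/-! ### Counting for the pair `x`, `y` -/

theorem card_common_of_sublist_cyclic {u v : List (Fin 3)} {p : Fin 3} {k : ℕ} {m : ℤ}
    (hu : u = cyclic p k) (h : u.Sublist v) (hm : m = k) (L : ℕ) :
    ((common L u v).card : ℤ) = cyclicCount L m := by
  rw [common_of_sublist h, hu, card_common_cyclic, hm]

theorem card_common_of_sublist_cyclic' {u v : List (Fin 3)} {p : Fin 3} {k : ℕ} {m : ℤ}
    (hv : v = cyclic p k) (h : v.Sublist u) (hm : m = k) (L : ℕ) :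
    ((common L u v).card : ℤ) = cyclicCount L m := by
  rw [common_comm, card_common_of_sublist_cyclic hv h hm]

theorem card_common_zero_one_two (L k : ℕ) :
    ((common (L + 1) ([0, 1, 2] ++ cyclic 0 k) ([1, 0, 2] ++ cyclic 0 k)).card : ℤ)
      = 2 * cyclicCount L (k + 1) + cyclicCount L k := by
  rw [card_common_succ, Fin.sum_univ_three]
  simp
  have h0 := card_common_of_sublist_cyclic' (u := 1 :: 2 :: cyclic 0 k) (v := 2 :: cyclic 0 k)
    (p := 2) (k := k + 1) (m := k + 1) rfl (by simp) (by simp) L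
  have h1 := card_common_of_sublist_cyclic (v := 0 :: 2 :: cyclic 0 k) (u := 2 :: cyclic 0 k)
    (p := 2) (k := k + 1) (m := k + 1) rfl (by simp) (by simp) L
  have h2 := card_common_cyclic L 0 k
  rw [h0, h1, h2]
  ring

/-- The remainders of `x` and `y` after the prefix `0, 1`. For the symbol `1` the second sequence
must look inside its periodic tail, whence the length `k - 2`. -/
theorem card_common_two_zero_one_two (L k : ℕ) :
    ((common (L + 1) ([2, 0, 1, 2] ++ cyclic 0 k) ([0, 2] ++ cyclic 0 k)).card : ℤ)
      = cyclicCount L (k + 1) + cyclicCount L k + cyclicCount L (k - 2) := by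
  have h0 := card_common_of_sublist_cyclic' (u := 1 :: 2 :: cyclic 0 k) (v := 2 :: cyclic 0 k)
    (p := 2) (k := k + 1) (m := k + 1) rfl (by simp) (by simp) L
  have h1 : ((countOpt L (some (2 :: cyclic 0 k)) (after 1 (cyclic 0 k)) : ℕ) : ℤ)
      = cyclicCount L (k - 2) := by
    rcases k with _ | _ | k
    · simp [cyclicCount_neg]
    · simp [cyclic_succ, cyclicCount_neg]
    · have h : (cyclic 2 k).Sublist (2 :: cyclic 0 (k + 2)) :=
        cyclic_sublist_cyclic 2 (show k ≤ k + 3 by omega)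
      exact card_common_of_sublist_cyclic' (v := cyclic 2 k) rfl h (by push_cast; ring) L
  have h2 := card_common_of_sublist_cyclic' (u := 0 :: 1 :: 2 :: cyclic 0 k) (v := cyclic 0 k)
    (m := k) rfl ((((List.Sublist.refl _).cons _).cons _).cons _) rfl L
  rw [card_common_succ, Fin.sum_univ_three]
  push_cast
  simp only [List.cons_append, List.nil_append, after_cons, Fin.reduceEq, if_true, if_false,
    countOpt_some]
  rw [h0, h1, h2]
  ring

theorem card_common_seqXY (L k : ℕ) :
    ((common (L + 3) ([0, 1, 2, 0, 1, 2] ++ cyclic 0 k)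
      ([1, 0, 2, 1, 0, 2] ++ cyclic 0 k)).card : ℤ)
      = cyclicCount (L + 1) (k + 2) + 4 * cyclicCount (L + 1) (k + 1) + cyclicCount (L + 1) k
        + 5 * cyclicCount L (k + 1) + 3 * cyclicCount L k + cyclicCount L (k - 2) := by
  have h0 := card_common_of_sublist_cyclic' (u := 1 :: 2 :: cyclic 0 k) (v := 2 :: cyclic 0 k)
    (p := 2) (k := k + 1) (m := k + 1) rfl (by simp) (by simp) (L + 1)
  have h1 := card_common_of_sublist_cyclic (v := 0 :: 2 :: cyclic 0 k) (u := 2 :: cyclic 0 k)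
    (p := 2) (k := k + 1) (m := k + 1) rfl (by simp) (by simp) (L + 1)
  have h2 := card_common_of_sublist_cyclic (u := 1 :: 2 :: cyclic 0 k)
    (v := 2 :: 1 :: 0 :: 2 :: cyclic 0 k) (p := 1) (k := k + 2) (m := k + 2) rfl
    (by simp [List.cons_sublist_cons]) (by simp) (L + 1)
  have h3 := card_common_two_zero_one_two L k
  have h4 := card_common_zero_one_two L k
  have h5 := card_common_zero_one_two (L + 1) k
  simp only [List.cons_append, List.nil_append] at h3 h4 h5
  rw [card_common_succ, Fin.sum_univ_three]
  simp only [List.cons_append, List.nil_append, after_cons, Fin.reduceEq, if_true, if_false,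
    countOpt_some]
  rw [card_common_succ, card_common_succ, Fin.sum_univ_three, Fin.sum_univ_three]
  simp only [after_cons, Fin.reduceEq, if_true, if_false, countOpt_some]
  push_cast
  rw [h0, h1, h2, h3, h4, h5]
  ring

/-! ### Counting for the pair `x₀`, `y₀` -/

/-- Two cyclic sequences of equal length and different phase agree in phase after any symbol. -/
theorem card_common_cyclic_one_two (L k : ℕ) :
    ((common (L + 1) (cyclic 1 k) (cyclic 2 k)).card : ℤ)
      = 2 * cyclicCount L (k - 3) + cyclicCount L (k - 2) := by
  rw [card_common_succ, Fin.sum_univ_three]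
  rcases k with _ | _ | _ | k
  · simp [cyclicCount_neg]
  · simp [cyclic_succ, cyclicCount_neg]
  · have := card_common_cyclic L 0 0
    simp only [cyclic_zero, Nat.cast_zero] at this
    simp [cyclic_succ, cyclicCount_neg, common_of_sublist (List.nil_sublist [(0 : Fin 3)]), this]
  · have h0 := card_common_of_sublist_cyclic (m := k) (u := cyclic 1 k) rfl
      (cyclic_sublist_cyclic 1 (show k ≤ k + 1 by omega)) rfl L
    have h1 := card_common_of_sublist_cyclic' (m := k) (v := cyclic 2 k) rfl
      (cyclic_sublist_cyclic 2 (show k ≤ k + 2 by omega)) rfl L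
    have h2 := card_common_of_sublist_cyclic (m := k + 1) (u := cyclic 0 (k + 1))
      (v := cyclic 0 (k + 2)) rfl (cyclic_sublist_cyclic 0 (by omega)) (by simp) L
    simp only [cyclic_succ, Fin.reduceAdd] at h0 h1 h2
    simp only [cyclic_succ, Fin.reduceAdd, after_cons, Fin.reduceEq, if_true, if_false,
      countOpt_some]
    push_cast
    rw [h0, h1, h2, show (k : ℤ) + 1 + 1 + 1 - 3 = k by ring,
      show (k : ℤ) + 1 + 1 + 1 - 2 = k + 1 by ring]
    ring

/-- The appended symbol breaks the period at the right end, so the split is by last symbol: the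
appended one leaves the out-of-phase pair, and each other one leaves a cyclic sequence inside
another. -/
theorem card_common_cyclic_append (L j : ℕ) :
    ((common (L + 1) (cyclic 1 j ++ [Fin.ofNat 3 j + 2]) (cyclic 2 (j + 2))).card : ℤ)
      = (common L (cyclic 1 j) (cyclic 2 j)).card + cyclicCount L (j - 1)
        + cyclicCount L (j - 3) := by
  rw [card_common_succ', sum_fin_three _ (Fin.ofNat 3 j)]
  have h2 : countOpt L (before (Fin.ofNat 3 j + 2) (cyclic 1 j ++ [Fin.ofNat 3 j + 2]))
      (before (Fin.ofNat 3 j + 2) (cyclic 2 (j + 2)))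
      = (common L (cyclic 1 j) (cyclic 2 j)).card := by
    have e1 : 2 + (Fin.ofNat 3 j + 1) ≠ Fin.ofNat 3 j + 2 := by
      generalize Fin.ofNat 3 j = q; decide +revert
    rw [cyclic_succ' 2 (j + 1), cyclic_succ' 2 j, before_concat, if_pos rfl, before_concat,
      ofNat_succ, if_neg e1, before_concat, if_pos (add_comm _ _), countOpt_some]
  have h0 : ((countOpt L (before (Fin.ofNat 3 j) (cyclic 1 j ++ [Fin.ofNat 3 j + 2]))
      (before (Fin.ofNat 3 j) (cyclic 2 (j + 2))) : ℕ) : ℤ) = cyclicCount L (j - 1) := by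
    rcases j with _ | i
    · rw [show before (Fin.ofNat 3 0) (cyclic 1 0 ++ [Fin.ofNat 3 0 + 2]) = none from rfl]
      simp [cyclicCount_neg]
    · have e1 : Fin.ofNat 3 (i + 1) + 2 ≠ Fin.ofNat 3 (i + 1) := by
        generalize Fin.ofNat 3 (i + 1) = q; decide +revert
      have e2 : 2 + Fin.ofNat 3 (i + 1 + 1) = Fin.ofNat 3 (i + 1) := by
        rw [ofNat_succ (i + 1)]; generalize Fin.ofNat 3 (i + 1) = q; decide +revert
      have e3 : 1 + Fin.ofNat 3 i = Fin.ofNat 3 (i + 1) := by rw [ofNat_succ, add_comm]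
      rw [before_concat, if_neg e1, cyclic_succ' 2 (i + 2), before_concat, if_pos e2,
        cyclic_succ' 1 i, before_concat, if_pos e3, countOpt_some]
      exact card_common_of_sublist_cyclic rfl
        (((List.Sublist.refl (cyclic 1 i)).cons 0).cons 2) (by push_cast; ring) L
  have h1 : ((countOpt L (before (Fin.ofNat 3 j + 1) (cyclic 1 j ++ [Fin.ofNat 3 j + 2]))
      (before (Fin.ofNat 3 j + 1) (cyclic 2 (j + 2))) : ℕ) : ℤ) = cyclicCount L (j - 3) := by
    rcases j with _ | _ | _ | i
    · rw [show before _ (cyclic 1 0 ++ [Fin.ofNat 3 0 + 2]) = none from rfl]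
      simp [cyclicCount_neg]
    · rw [before_concat, show before _ (cyclic 1 (0 + 1)) = none from rfl]
      simp [cyclicCount_neg]
    · rw [before_concat, show before _ (cyclic 1 (0 + 1 + 1)) = none from rfl]
      simp [cyclicCount_neg]
    -- The last occurrence of this symbol is the first of the final three symbols of `cyclic 1 (i +
    -- 3)`.
    · have h : before (Fin.ofNat 3 (i + 3) + 1) (cyclic 1 (i + 3) ++ [Fin.ofNat 3 (i + 3) + 2])
          = some (cyclic 1 i) := by
        rw [cyclic_succ' 1 (i + 2), cyclic_succ' 1 (i + 1), cyclic_succ' 1 i]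
        simp only [before_concat, ofNat_succ]
        generalize Fin.ofNat 3 i = q
        fin_cases q <;> rfl
      have h' : before (Fin.ofNat 3 (i + 3) + 1) (cyclic 2 (i + 3 + 2))
          = some (cyclic 2 (i + 2)) := by
        rw [cyclic_succ' 2 (i + 4), cyclic_succ' 2 (i + 3), cyclic_succ' 2 (i + 2)]
        simp only [before_concat, ofNat_succ]
        generalize Fin.ofNat 3 i = q
        fin_cases q <;> rfl
      rw [h, h', countOpt_some]
      exact card_common_of_sublist_cyclic rfl
        (((List.Sublist.refl (cyclic 1 i)).cons 0).cons 2) (by push_cast; ring) L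
  push_cast [h0, h1, h2]
  ring

theorem card_common_two_append (L j : ℕ) :
    ((common (L + 2) ([2] ++ cyclic 0 (j + 1) ++ [Fin.ofNat 3 j + 2])
      ([0, 2] ++ cyclic 0 (j + 1))).card : ℤ)
      = cyclicCount (L + 1) (j + 1) + cyclicCount (L + 1) (j - 1)
        + ((common L (cyclic 1 j) (cyclic 2 j)).card + cyclicCount L (j - 1)
          + cyclicCount L (j - 3)) := by
  have h0 := card_common_cyclic_append L j
  have h2 := card_common_of_sublist_cyclic' (m := j + 1) rfl
    (List.sublist_append_left (cyclic 0 (j + 1)) [Fin.ofNat 3 j + 2]) (by simp) (L + 1)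
  have h1 : ((countOpt (L + 1) (after 1 (cyclic 1 j ++ [Fin.ofNat 3 j + 2]))
      (after 1 (cyclic 1 j)) : ℕ) : ℤ) = cyclicCount (L + 1) (j - 1) := by
    rcases j with _ | i
    · simp [cyclicCount_neg]
    · exact card_common_of_sublist_cyclic' (v := cyclic 2 i) rfl
        (List.sublist_append_left _ _) (by push_cast; ring) _
  simp only [cyclic_succ, Fin.reduceAdd, List.cons_append] at h0 h2
  rw [card_common_succ, Fin.sum_univ_three]
  simp only [cyclic_succ, Fin.reduceAdd, List.cons_append, List.nil_append, after_cons,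
    Fin.reduceEq, if_true, if_false, countOpt_some]
  push_cast
  rw [h0, h1, h2]
  ring

theorem card_common_append_left (L j : ℕ) :
    ((common (L + 3) ([0, 1, 2] ++ cyclic 0 (j + 1) ++ [Fin.ofNat 3 j + 2])
      ([1, 0, 2] ++ cyclic 0 (j + 1))).card : ℤ)
      = cyclicCount (L + 2) (j + 2) + cyclicCount (L + 2) (j + 1)
        + (cyclicCount (L + 1) (j + 1) + cyclicCount (L + 1) (j - 1)
        + ((common L (cyclic 1 j) (cyclic 2 j)).card + cyclicCount L (j - 1)
          + cyclicCount L (j - 3))) := by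
  have h0 := card_common_of_sublist_cyclic' (m := j + 2) (p := 2) (k := j + 2)
    (u := 1 :: 2 :: (cyclic 0 (j + 1) ++ [Fin.ofNat 3 j + 2])) (v := 2 :: cyclic 0 (j + 1)) rfl
    (((List.sublist_append_left _ _).cons_cons _).cons _) (by simp) (L + 2)
  have h1 := card_common_two_append L j
  have h2 := card_common_of_sublist_cyclic' (m := j + 1) rfl
    (List.sublist_append_left (cyclic 0 (j + 1)) [Fin.ofNat 3 j + 2]) (by simp) (L + 2)
  simp only [List.cons_append, List.nil_append] at h0 h1 h2
  rw [card_common_succ, Fin.sum_univ_three]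
  simp only [List.cons_append, List.nil_append, after_cons,
    Fin.reduceEq, if_true, if_false, countOpt_some]
  push_cast
  rw [h0, h1, h2]
  ring

theorem card_common_append_right (L k : ℕ) :
    ((common (L + 2) ([0, 1, 2] ++ cyclic 0 k) ([1, 0, 2] ++ cyclic 0 (k + 1))).card : ℤ)
      = cyclicCount (L + 1) (k + 1) + cyclicCount (L + 1) k
        + (2 * cyclicCount L (k - 1) + cyclicCount L k) := by
  -- These are `cyclic 1 (k + 2)` and `cyclic 2 (k + 2)`, the out-of-phase case.
  have h0 : ((common (L + 1) (1 :: 2 :: cyclic 0 k) (2 :: cyclic 0 (k + 1))).card : ℤ)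
      = 2 * cyclicCount L (k - 1) + cyclicCount L k := by
    have h := card_common_cyclic_one_two L (k + 2)
    push_cast at h
    rw [show (k : ℤ) + 2 - 3 = k - 1 by ring, add_sub_cancel_right] at h
    exact h
  have h1 := card_common_of_sublist_cyclic (m := k + 1) (p := 2) (k := k + 1)
    (u := 2 :: cyclic 0 k) (v := 0 :: 2 :: cyclic 0 (k + 1)) rfl
    (((cyclic_sublist_cyclic 0 (by omega)).cons_cons _).cons _) (by simp) (L + 1)
  have h2 := card_common_of_sublist_cyclic (m := k) (p := 0) (k := k) rfl
    (cyclic_sublist_cyclic 0 (show k ≤ k + 1 by omega)) (by simp) (L + 1)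
  rw [card_common_succ, Fin.sum_univ_three]
  simp only [List.cons_append, List.nil_append, after_cons,
    Fin.reduceEq, if_true, if_false, countOpt_some]
  push_cast
  rw [h0, h1, h2]
  ring

/-- Removing the last symbol separates the swap at the end from the one at the start. The three
cases are two tails of equal length, a leftover symbol on the left, and a longer periodic tail on
the right. -/
theorem card_common_seqXY₀ (L j : ℕ) :
    ((common (L + 4)
      ([0, 1, 2] ++ cyclic 0 (j + 1) ++ [Fin.ofNat 3 (j + 2), Fin.ofNat 3 (j + 1)])
      ([1, 0, 2] ++ cyclic 0 (j + 3))).card : ℤ)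
      = 2 * cyclicCount (L + 2) (j + 2) + 4 * cyclicCount (L + 2) (j + 1)
        + cyclicCount (L + 2) j + 2 * cyclicCount (L + 1) (j + 1) + 2 * cyclicCount (L + 1) j
        + cyclicCount (L + 1) (j - 1) + cyclicCount L (j - 1) + cyclicCount L (j - 3)
        + (common L (cyclic 1 j) (cyclic 2 j)).card := by
  have h1 := card_common_append_left L j
  have h2 := card_common_append_right (L + 1) (j + 1)
  have h0 := card_common_zero_one_two (L + 2) j
  rw [cyclic_succ' 0 (j + 2), cyclic_succ' 0 (j + 1)]
  rw [cyclic_succ' 0 (j + 1)] at h2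
  rw [cyclic_succ' 0 j] at h1 h2 ⊢
  simp only [ofNat_succ, zero_add] at h1 h2 ⊢
  rw [card_common_succ', sum_fin_three _ (Fin.ofNat 3 j)]
  generalize Fin.ofNat 3 j = q at h1 h2 ⊢
  have e1 : q + 1 ≠ q := (by decide : ∀ p : Fin 3, p + 1 ≠ p) q
  have e2 : q + 2 ≠ q := (by decide : ∀ p : Fin 3, p + 2 ≠ p) q
  have e3 : q + 1 + 1 = q + 2 := (by decide : ∀ p : Fin 3, p + 1 + 1 = p + 2) q
  have e4 : q + 2 ≠ q + 1 := (by decide : ∀ p : Fin 3, p + 2 ≠ p + 1) q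
  have hu : ∀ u v : List (Fin 3), u ++ (v ++ [q]) ++ [q + 2, q + 1]
      = u ++ v ++ [q] ++ [q + 2] ++ [q + 1] := fun u v => by simp
  have hv : ∀ u v : List (Fin 3), u ++ (v ++ [q] ++ [q + 1] ++ [q + 2])
      = u ++ v ++ [q] ++ [q + 1] ++ [q + 2] := fun u v => by simp
  rw [e3, hu, hv]
  simp only [before_concat, e1, e2, e4, e4.symm, if_true, if_false, countOpt_some]
  simp only [← List.append_assoc] at h0 h1 h2
  push_cast at h0 h1 h2 ⊢
  rw [h0, h1, h2, add_sub_cancel_right, show (j : ℤ) + 1 + 1 = j + 2 by ring]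
  ring


/-! ### Distances and intersection sizes in terms of `n` and `t` -/

theorem maxBall_three (m s : ℤ) :
    (maxBall 3 m s : ℤ) = if s ≤ m then cyclicCount (m - s).toNat m else 0 := by
  split_ifs with h
  · exact maxBall_eq_cyclicCount (by omega)
  · rw [maxBall_eq_zero (by omega), Nat.cast_zero]

theorem length_seqX {n : ℕ} (hn : 6 ≤ n) : (seqX n).length = n := by
  simp [seqX, periodicSeq]; omega

theorem length_seqY {n : ℕ} (hn : 6 ≤ n) : (seqY n).length = n := by
  simp [seqY, periodicSeq]; omega

theorem length_seqX₀ {n : ℕ} (hn : 6 ≤ n) : (seqX₀ n).length = n := by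
  simp [seqX₀, periodicSeq]; omega

theorem length_seqY₀ {n : ℕ} (hn : 6 ≤ n) : (seqY₀ n).length = n := by
  simp [seqY₀, periodicSeq]; omega

theorem card_common_seqX_seqY (L k : ℕ) {m : ℕ} (hm : m = L + 3) :
    ((common m (seqX (k + 6)) (seqY (k + 6))).card : ℤ)
      = cyclicCount (L + 1) (k + 2) + 4 * cyclicCount (L + 1) (k + 1) + cyclicCount (L + 1) k
        + 5 * cyclicCount L (k + 1) + 3 * cyclicCount L k + cyclicCount L (k - 2) := by
  rw [hm, ← card_common_seqXY, seqX, seqY, Nat.add_sub_cancel, periodicSeq_eq_cyclic]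

theorem card_common_seqX₀_seqY₀ (L k : ℕ) {m : ℕ} (hm : m = L + 4) :
    ((common m (seqX₀ (k + 6)) (seqY₀ (k + 6))).card : ℤ)
      = 2 * cyclicCount (L + 2) (k + 2) + 4 * cyclicCount (L + 2) (k + 1)
        + cyclicCount (L + 2) k + 2 * cyclicCount (L + 1) (k + 1) + 2 * cyclicCount (L + 1) k
        + cyclicCount (L + 1) (k - 1) + cyclicCount L (k - 1) + cyclicCount L (k - 3)
        + (common L (cyclic 1 k) (cyclic 2 k)).card := by
  rw [hm, ← card_common_seqXY₀, seqX₀, seqY₀, periodicSeq_eq_cyclic, periodicSeq_eq_cyclic]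
  rfl

/-- At lengths `n` and `n - 1` every term of the counting formula asks for a subsequence longer than
its sequence; at `n - 2` the leading term is `1`. -/
theorem levenshteinDist_seqX_seqY {n : ℕ} (hn : 6 ≤ n) :
    levenshteinDist (seqX n) (seqY n) = 2 := by
  refine levenshteinDist_eq_two (by omega) (length_seqX hn) (length_seqY hn) ?_ ?_ ?_
  all_goals obtain ⟨k, rfl⟩ := Nat.exists_eq_add_of_le' hn
  · have h := card_common_seqX_seqY (k + 3) k (m := k + 6) rfl
    simp (disch := push_cast; omega) only [cyclicCount_eq_zero] at h
    omega
  · have h := card_common_seqX_seqY (k + 2) k (m := k + 6 - 1) (by omega)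
    simp (disch := push_cast; omega) only [cyclicCount_eq_zero] at h
    omega
  · have h := card_common_seqX_seqY (k + 1) k (m := k + 6 - 2) (by omega)
    have h1 := cyclicCount_self (k + 2)
    push_cast at h1
    rw [h1] at h
    simp (disch := push_cast; omega) only [cyclicCount_eq_zero] at h
    have h2 := cyclicCount_nonneg (k + 1) (k + 1)
    omega

theorem levenshteinDist_seqX₀_seqY₀ {n : ℕ} (hn : 6 ≤ n) :
    levenshteinDist (seqX₀ n) (seqY₀ n) = 2 := by
  refine levenshteinDist_eq_two (by omega) (length_seqX₀ hn) (length_seqY₀ hn) ?_ ?_ ?_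
  all_goals obtain ⟨k, rfl⟩ := Nat.exists_eq_add_of_le' hn
  · have h := card_common_seqX₀_seqY₀ (k + 2) k (m := k + 6) rfl
    have h0 : common (k + 2) (cyclic 1 k) (cyclic 2 k) = ∅ :=
      common_eq_empty (by rw [length_cyclic]; omega)
    rw [h0, Finset.card_empty] at h
    simp (disch := push_cast; omega) only [cyclicCount_eq_zero] at h
    omega
  · have h := card_common_seqX₀_seqY₀ (k + 1) k (m := k + 6 - 1) (by omega)
    have h0 : common (k + 1) (cyclic 1 k) (cyclic 2 k) = ∅ :=
      common_eq_empty (by rw [length_cyclic]; omega)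
    rw [h0, Finset.card_empty] at h
    simp (disch := push_cast; omega) only [cyclicCount_eq_zero] at h
    omega
  · have h := card_common_seqX₀_seqY₀ k k (m := k + 6 - 2) (by omega)
    have h1 := cyclicCount_self (k + 2)
    push_cast at h1
    rw [h1] at h
    simp (disch := push_cast; omega) only [cyclicCount_eq_zero] at h
    have h2 := cyclicCount_nonneg (k + 1) (k + 1)
    omega

theorem card_inter_seqX_seqY {n t : ℕ} (hn : 6 ≤ n) (ht : t + 3 ≤ n) :
    ((deletionBall t (seqX n) ∩ deletionBall t (seqY n)).card : ℤ) = M₁ n t := by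
  rw [deletionBall_inter (length_seqX hn) (length_seqY hn) (by omega)]
  obtain ⟨k, rfl⟩ := Nat.exists_eq_add_of_le' hn
  obtain ⟨L, hL⟩ := Nat.exists_eq_add_of_le' (show 3 ≤ k + 6 - t by omega)
  have hd : (((k + 6 : ℕ) : ℤ)) - t = L + 3 := by omega
  rw [card_common_seqX_seqY L k hL, M₁]
  rw [maxBall_eq_cyclicCount (L := L + 1) (by push_cast; omega),
    maxBall_eq_cyclicCount (L := L) (by push_cast; omega),
    maxBall_eq_cyclicCount (L := L + 1) (by push_cast; omega),
    maxBall_eq_cyclicCount (L := L) (by push_cast; omega),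
    maxBall_eq_cyclicCount (L := L + 1) (by push_cast; omega),
    maxBall_eq_cyclicCount (L := L) (by push_cast; omega)]
  push_cast
  simp only [add_sub_assoc]
  norm_num
  ring_nf

theorem card_inter_seqX₀_seqY₀ {n t : ℕ} (hn : 9 ≤ n) (ht : t + 4 ≤ n) :
    ((deletionBall t (seqX₀ n) ∩ deletionBall t (seqY₀ n)).card : ℤ) = M₀ n t := by
  rw [deletionBall_inter (length_seqX₀ (by omega)) (length_seqY₀ (by omega)) (by omega)]
  obtain ⟨k, rfl⟩ := Nat.exists_eq_add_of_le' (show 6 ≤ n by omega)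
  obtain ⟨L, hL⟩ := Nat.exists_eq_add_of_le' (show 4 ≤ k + 6 - t by omega)
  have hd : (((k + 6 : ℕ) : ℤ)) - t = L + 4 := by omega
  rw [card_common_seqX₀_seqY₀ L k hL, M₀]
  rw [maxBall_eq_cyclicCount (L := L + 2) (by push_cast; omega),
    maxBall_eq_cyclicCount (L := L + 1) (by push_cast; omega),
    maxBall_eq_cyclicCount (L := L + 2) (by push_cast; omega),
    maxBall_eq_cyclicCount (L := L + 1) (by push_cast; omega),
    maxBall_eq_cyclicCount (L := L + 2) (by push_cast; omega),
    maxBall_eq_cyclicCount (L := L) (by push_cast; omega),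
    maxBall_eq_cyclicCount (L := L + 1) (by push_cast; omega),
    maxBall_eq_cyclicCount (L := L) (by push_cast; omega)]
  push_cast
  simp only [add_sub_assoc]
  norm_num
  simp only [← sub_eq_add_neg]
  -- The count has this term twice and `M₀` once; expanding it aligns the terms of index `L + 1`.
  have e : cyclicCount (L + 2) (k + 2) = cyclicCount (L + 1) (k + 1) + cyclicCount (L + 1) k
      + cyclicCount (L + 1) (k - 1) := by
    rw [cyclicCount_succ]
    ring_nf
  -- For `L = 0` the last two balls of `M₀` are empty and the out-of-phase count is `1`. Only here
  -- is `n ≥ 9`, that is `k ≥ 3`, needed: `cyclicCount 0 (k - 3)` must be `1`.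
  rcases L with _ | L
  · rw [maxBall_eq_zero (m := (k : ℤ) - 6) (by omega),
      maxBall_eq_zero (m := (k : ℤ) - 4) (by omega), e]
    simp [cyclicCount, show 3 ≤ k by omega, show 2 ≤ k by omega, show 1 ≤ k by omega]
    ring
  · rw [maxBall_eq_cyclicCount (L := L) (by omega),
      maxBall_eq_cyclicCount (L := L) (by omega), e, card_common_cyclic_one_two]
    have e1 := cyclicCount_succ L (k - 1)
    have e2 := cyclicCount_succ L (k - 2)
    have e3 := cyclicCount_succ L (k - 3)
    simp only [sub_sub] at e1 e2 e3
    norm_num at e1 e2 e3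
    rw [e1, e2, e3]
    ring_nf

theorem card_inter_le_maxIntersection {q n d t : ℕ} {u v : List (Fin q)} (hu : u.length = n)
    (hv : v.length = n) (h : d ≤ levenshteinDist u v) :
    (deletionBall t u ∩ deletionBall t v).card ≤ maxIntersection q n d t := by
  unfold maxIntersection
  exact Finset.le_sup
    (f := fun p : List.Vector (Fin q) n × List.Vector (Fin q) n =>
      (deletionBall t p.1.toList ∩ deletionBall t p.2.toList).card)
    (Finset.mem_filter.2 ⟨Finset.mem_univ
      (show List.Vector (Fin q) n × List.Vector (Fin q) n from (⟨u, hu⟩, ⟨v, hv⟩)), h⟩)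

/-- Covers the lengths for which the size formula for `x₀`, `y₀` is not available; finitely many
`(n, t)` remain, and `maxBall_three` makes each one a computation. -/
theorem M₀_le_M₁ {n t : ℕ} (ht : 2 ≤ t) (hn : 6 ≤ n) (hn' : n ≤ 8) (h : 3 * t / 2 + 1 ≤ n) :
    M₀ n t ≤ M₁ n t := by
  have : t ≤ 5 := by omega
  simp only [M₀, M₁, maxBall_three]
  interval_cases n <;> interval_cases t <;> first | omega | decide

end DeletionChannel

theorem theorem5 (n t : ℕ) (ht : 2 ≤ t) (hn : max 6 (3 * t / 2 + 1) ≤ n) :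
    -- the lower bound
    max (DeletionChannel.M₀ n t) (DeletionChannel.M₁ n t)
        ≤ (DeletionChannel.maxIntersection 3 n 2 t : ℤ) ∧
    -- the pair `x, y`
    ((DeletionChannel.seqX n).length = n ∧ (DeletionChannel.seqY n).length = n ∧
      DeletionChannel.levenshteinDist (DeletionChannel.seqX n) (DeletionChannel.seqY n) = 2 ∧
      ((DeletionChannel.deletionBall t (DeletionChannel.seqX n) ∩
        DeletionChannel.deletionBall t (DeletionChannel.seqY n)).card : ℤ)
          = DeletionChannel.M₁ n t) ∧
    -- the pair `x₀, y₀`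
    ((DeletionChannel.seqX₀ n).length = n ∧ (DeletionChannel.seqY₀ n).length = n ∧
      DeletionChannel.levenshteinDist (DeletionChannel.seqX₀ n) (DeletionChannel.seqY₀ n) = 2 ∧
      (9 ≤ n →
        ((DeletionChannel.deletionBall t (DeletionChannel.seqX₀ n) ∩
          DeletionChannel.deletionBall t (DeletionChannel.seqY₀ n)).card : ℤ)
            = DeletionChannel.M₀ n t)) := by
  open DeletionChannel in
  obtain ⟨h6, h⟩ := max_le_iff.1 hn
  -- From `n - t ≥ t / 2 + 1` and `n ≥ 6` at least three symbols survive, and at least four if `n ≥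
  -- 9`; the formulas have `L + 3` and `L + 4`.
  have hc := card_inter_seqX_seqY h6 (show t + 3 ≤ n by omega)
  have hd := levenshteinDist_seqX_seqY h6
  have hd₀ := levenshteinDist_seqX₀_seqY₀ h6
  have hc₀ : 9 ≤ n → _ := fun h9 => card_inter_seqX₀_seqY₀ h9 (show t + 4 ≤ n by omega)
  have hle : M₁ n t ≤ maxIntersection 3 n 2 t := by
    rw [← hc, Nat.cast_le]
    exact card_inter_le_maxIntersection (length_seqX h6) (length_seqY h6) hd.ge
  refine ⟨max_le ?_ hle, ⟨length_seqX h6, length_seqY h6, hd, hc⟩,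
    length_seqX₀ h6, length_seqY₀ h6, hd₀, hc₀⟩
  rcases Nat.lt_or_ge n 9 with h9 | h9
  · exact (M₀_le_M₁ ht h6 (by omega) h).trans hle
  · rw [← hc₀ h9, Nat.cast_le]
    exact card_inter_le_maxIntersection (length_seqX₀ h6) (length_seqY₀ h6) hd₀.ge
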